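/- **Theorem (Distance to the closest BTL model).** Let $n\ge 2$, let $\mathcal G=([n],\mathcal E)$ be a connected undirected graph, where by convention $\mathcal E$ also contains all self-loops, let $E\in\{0,1\}^{n\times n}$ be its adjacency matrix (with $E_{ii}=1$), and put $\mathcal P_{\mathcal E}(X)=X\odot E$ (entrywise product), $d_{\max}=\max_i\sum_j E_{ij}$, $d_{\min}=\min_i\sum_{j\ne i}E_{ij}$. Let $P\in\mathbb R^{n\times n}$ be a pairwise comparison matrix on $\mathcal E$: $P_{ij}=p_{ij}\in(0,1)$ if $(i,j)\in\mathcal E$ and $i\neq j$, $P_{ii}=p_{ii}=\tfrac12$, and $P_{ij}=0$ if $(i,j)\notin\mathcal E$. With $d=2d_{\max}$, let $S$ be its canonical Markov matrix: $S_{ij}=p_{ij}/d$ if $i\ne j$ and $(i,j)\in\mathcal E$, $S_{ij}=0$ if $(i,j)\notin\mathcal E$, and $S_{ii}=1-\frac1d\sum_{k\neq i,\,(i,k)\in\mathcal E}p_{ik}$. Let $\pi$ be the stationary distribution of $S$ and $\Pi=\operatorname{diag}(\pi)$. For constants $\delta\in(0,1)$ and $\xi,\kappa,h>0$, assume: 1.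 (dynamic range) $\frac{\delta}{1+\delta}\le p_{ij}\le\frac1{1+\delta}$ for all $(i,j)\in\mathcal E$; 2. (edge expansion) the matrix $R=\Pi^{1/2}S\Pi^{-1/2}$, whose normalized left and right Perron–Frobenius eigenvectors are both $u=v=\sqrt\pi$, satisfies $$\phi(R)=\min_{\emptyset\ne T\subsetneq[n]}\frac{\sum_{i\in T,\,j\notin T}R_{ij}u_iv_j}{\min\{\sum_{i\in T}u_iv_i,\ \sum_{i\notin T}u_iv_i\}}\ \ge\ \xi;$$ 3. (almost regular graph) $d_{\max}/d_{\min}\le\kappa$; 4. (bounded principal ratio) $\max_i\pi_i/\min_j\pi_j\le h$. Let $\mathrm{BTL}_h$ be the set of all matrices $B\in\mathbb R^{n\times n}$ with $B_{ij}=\frac{\alpha_j}{\alpha_i+\alpha_j}$ for all $i,j$, for some skill scores $\alpha_1,\dots,\alpha_n>0$ with $\max_i\alpha_i/\min_j\alpha_j\le h$ (the choice $h=\delta^{-1}$ is the one of main interest). Then there are constants $c_1,c_2>0$ depending only on $\delta,\xi,\kappa,h$ (in particular independent of $n$, $\mathcal G$ and $P$) such that the minimum of $\|P-\mathcal P_{\mathcal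 E}(B)\|_F$ over $B\in\mathrm{BTL}_h$ is attained and $$c_1\,\frac{\|\Pi P+P\Pi-\mathcal P_{\mathcal E}(\mathbf 1_n\pi^{T})\|_F}{\|\pi\|_\infty}\ \le\ \min_{B\in\mathrm{BTL}_h}\|P-\mathcal P_{\mathcal E}(B)\|_F\ \le\ c_2\,\frac{\|\Pi P+P\Pi-\mathcal P_{\mathcal E}(\mathbf 1_n\pi^{T})\|_F}{\|\pi\|_\infty}.$$ -/

import Mathlib

open scoped Matrix Matrix.Norms.Frobenius

noncomputable section

namespace BTL

variable {n : ℕ}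

/-! ### Observation graph

The observation graph is a simple graph `G` on the agents `Fin n`; the edge set of the model is the
set of ordered adjacent pairs together with all self-loops. -/

open Classical in
/-- The 0-1 adjacency matrix `E` of the observation graph, with self-loops included. -/
def adjLoop (G : SimpleGraph (Fin n)) : Matrix (Fin n) (Fin n) ℝ :=
  Matrix.of fun i j => if i = j ∨ G.Adj i j then 1 else 0

/-- The projection `P_E(X) = X ⊙ E` (Hadamard product). -/
def proj (G : SimpleGraph (Fin n)) (X : Matrix (Fin n) (Fin n) ℝ) : Matrix (Fin n) (Fin n) ℝ :=
  X ⊙ adjLoop G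

/-- `d_max = max_i ∑_j E_ij` (self-loops are counted). -/
def dMax (G : SimpleGraph (Fin n)) : ℝ := ⨆ i, ∑ j, adjLoop G i j

/-- `d_min = min_i ∑_{j ≠ i} E_ij` (self-loops are not counted). -/
def dMin (G : SimpleGraph (Fin n)) : ℝ := ⨅ i, ∑ j ∈ Finset.univ.erase i, adjLoop G i j

/-! ### Pairwise comparison models -/

/-- `P` is the matrix of a pairwise comparison model on `G`: `P i j = p_ij ∈ (0,1)` is the
probability that `j` beats `i` for each edge `(i, j)` with `i ≠ j`, the diagonal is `1/2`, and
the entries of unobserved pairs vanish. -/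
structure IsPairwiseComparisonMatrix (G : SimpleGraph (Fin n)) (P : Matrix (Fin n) (Fin n) ℝ) :
    Prop where
  mem_Ioo : ∀ i j, G.Adj i j → P i j ∈ Set.Ioo (0 : ℝ) 1
  diag : ∀ i, P i i = 1 / 2
  off : ∀ i j, i ≠ j → ¬ G.Adj i j → P i j = 0

open Classical in
/-- The canonical Markov matrix of `P`, with parameter `d = 2 d_max`. -/
def canonicalMarkov (G : SimpleGraph (Fin n)) (P : Matrix (Fin n) (Fin n) ℝ) :
    Matrix (Fin n) (Fin n) ℝ :=
  Matrix.of fun i j =>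
    if i = j then 1 - (1 / (2 * dMax G)) * ∑ k with G.Adj i k, P i k
    else if G.Adj i j then P i j / (2 * dMax G) else 0

/-- `π` is a stationary distribution of the Markov matrix `S`: a probability vector, `πᵀ S = πᵀ`. -/
def IsStationary (S : Matrix (Fin n) (Fin n) ℝ) (π : Fin n → ℝ) : Prop :=
  π ∈ stdSimplex ℝ (Fin n) ∧ π ᵥ* S = π

/-- The ratio of the largest to the smallest entry of a positive vector: the principal ratio of a
stationary distribution, and the condition number of a vector of skill scores. -/
def maxMinRatio (x : Fin n → ℝ) : ℝ := (⨆ i, x i) / (⨅ j, x j)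

/-- `B` belongs to the class of pairwise comparison matrices (of all pairs of agents) of BTL models
whose skill scores have condition number at most `h`. -/
def btlClass (n : ℕ) (h : ℝ) : Set (Matrix (Fin n) (Fin n) ℝ) :=
  {B | IsPairwiseComparisonMatrix ⊤ B ∧
    ∃ α : Fin n → ℝ, (∀ i, 0 < α i) ∧ maxMinRatio α ≤ h ∧
      ∀ i j, i ≠ j → B i j = α j / (α i + α j)}

/-! ### Divergence transition matrix and edge expansion -/

/-- The divergence transition matrix `Π^{1/2} S Π^{-1/2}`. -/
def dtm (S : Matrix (Fin n) (Fin n) ℝ) (π : Fin n → ℝ) : Matrix (Fin n) (Fin n) ℝ :=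
  Matrix.diagonal (fun i => √(π i)) * S * Matrix.diagonal (fun i => (√(π i))⁻¹)

/-- `u`, `v` are entrywise positive left and right eigenvectors of `R` for the eigenvalue `1`,
normalized by `uᵀ v = 1`. -/
structure IsPerronPair (R : Matrix (Fin n) (Fin n) ℝ) (u v : Fin n → ℝ) : Prop where
  left_pos : ∀ i, 0 < u i
  right_pos : ∀ i, 0 < v i
  left_eigen : u ᵥ* R = u
  right_eigen : R *ᵥ v = v
  normalized : u ⬝ᵥ v = 1

/-- The edge expansion of a non-negative matrix `R` with Perron pair `u`, `v`:
the minimum over the nonempty proper subsets `T` of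
`(∑_{i ∈ T, j ∉ T} R_ij u_i v_j) / min (∑_{i ∈ T} u_i v_i) (∑_{i ∉ T} u_i v_i)`. -/
def edgeExpansion (R : Matrix (Fin n) (Fin n) ℝ) (u v : Fin n → ℝ) : ℝ :=
  ⨅ T : {T : Finset (Fin n) // T.Nonempty ∧ (T : Finset (Fin n))ᶜ.Nonempty},
    (∑ i ∈ T.1, ∑ j ∈ T.1ᶜ, R i j * u i * v j) /
      min (∑ i ∈ T.1, u i * v i) (∑ i ∈ T.1ᶜ, u i * v i)

/-- The canonical Markov matrix has row sums `1`. -/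
theorem canonicalMarkov_mulVec_one (G : SimpleGraph (Fin n)) (P : Matrix (Fin n) (Fin n) ℝ) :
    canonicalMarkov G P *ᵥ 1 = 1 := by
  classical
  ext i
  have h1 : ∑ j, canonicalMarkov G P i j = canonicalMarkov G P i i +
      ∑ j ∈ Finset.univ.erase i, canonicalMarkov G P i j :=
    (Finset.add_sum_erase _ _ (Finset.mem_univ i)).symm
  have h2 : ∑ j ∈ Finset.univ.erase i, canonicalMarkov G P i j =
      ∑ k with G.Adj i k, P i k / (2 * dMax G) := by
    rw [Finset.sum_filter, ← Finset.add_sum_erase _ _ (Finset.mem_univ i)]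
    simp only [SimpleGraph.irrefl, if_false, zero_add]
    refine Finset.sum_congr rfl fun j hj => ?_
    have hij : i ≠ j := (Finset.ne_of_mem_erase hj).symm
    simp [canonicalMarkov, hij]
  have h3 : canonicalMarkov G P i i =
      1 - (1 / (2 * dMax G)) * ∑ k with G.Adj i k, P i k := by
    simp [canonicalMarkov]
  simp only [Matrix.mulVec, dotProduct, Pi.one_apply, mul_one]
  rw [h1, h2, h3, ← Finset.sum_div]
  ring

/-- If `π` is a positive stationary distribution of the stochastic matrix `S`, then `√π`, `√π` is
the Perron pair of the divergence transition matrix. -/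
theorem isPerronPair_dtm {S : Matrix (Fin n) (Fin n) ℝ} {π : Fin n → ℝ} (hS : S *ᵥ 1 = 1)
    (hπ : IsStationary S π) (hpos : ∀ i, 0 < π i) :
    IsPerronPair (dtm S π) (fun i => √(π i)) (fun i => √(π i)) where
  left_pos i := Real.sqrt_pos.2 (hpos i)
  right_pos i := Real.sqrt_pos.2 (hpos i)
  left_eigen := by
    have h1 : (fun i => √(π i)) ᵥ* Matrix.diagonal (fun i => √(π i)) = π := by
      ext i; simp [Matrix.vecMul_diagonal, Real.mul_self_sqrt (hpos i).le]
    rw [dtm, ← Matrix.vecMul_vecMul, ← Matrix.vecMul_vecMul, h1, hπ.2]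
    ext i
    rw [Matrix.vecMul_diagonal, ← div_eq_mul_inv, Real.div_sqrt]
  right_eigen := by
    have h1 : Matrix.diagonal (fun i => (√(π i))⁻¹) *ᵥ (fun i => √(π i)) = 1 := by
      ext i
      simp [Matrix.mulVec_diagonal, inv_mul_cancel₀ (Real.sqrt_pos.2 (hpos i)).ne']
    rw [dtm, ← Matrix.mulVec_mulVec, ← Matrix.mulVec_mulVec, h1, hS]
    ext i
    simp [Matrix.mulVec_diagonal]
  normalized := by
    rw [← hπ.1.2]
    exact Finset.sum_congr rfl fun i _ => Real.mul_self_sqrt (hpos i).le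

/-! ### The four regularity assumptions -/

/-- Dynamic range: `δ/(1+δ) ≤ p_ij ≤ 1/(1+δ)` on all edges (self-loops included). -/
def DynamicRange (G : SimpleGraph (Fin n)) (P : Matrix (Fin n) (Fin n) ℝ) (δ : ℝ) : Prop :=
  ∀ i j, (i = j ∨ G.Adj i j) → δ / (1 + δ) ≤ P i j ∧ P i j ≤ 1 / (1 + δ)

/-- Large edge expansion of the divergence transition matrix of `P`, whose Perron pair is
`√π`, `√π`. -/
def LargeExpansion (G : SimpleGraph (Fin n)) (P : Matrix (Fin n) (Fin n) ℝ) (π : Fin n → ℝ)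
    (ξ : ℝ) : Prop :=
  ξ ≤ edgeExpansion (dtm (canonicalMarkov G P) π) (fun i => √(π i)) (fun i => √(π i))

/-- The graph is connected and almost regular. -/
def AlmostRegular (G : SimpleGraph (Fin n)) (κ : ℝ) : Prop :=
  G.Connected ∧ dMax G / dMin G ≤ κ

/-- Bounded principal ratio. -/
def BoundedPrincipalRatio (π : Fin n → ℝ) (h : ℝ) : Prop := maxMinRatio π ≤ h

/-! ### The two distances -/

/-- The separation quantity `‖Π P + P Π - P_E(1 πᵀ)‖_F / ‖π‖_∞`. The norm of a matrix is the
Frobenius norm, the norm of a vector in `Fin n → ℝ` is the supremum norm. -/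
def separation (G : SimpleGraph (Fin n)) (P : Matrix (Fin n) (Fin n) ℝ) (π : Fin n → ℝ) : ℝ :=
  ‖Matrix.diagonal π * P + P * Matrix.diagonal π - proj G (Matrix.vecMulVec 1 π)‖ / ‖π‖

/-- The set of Frobenius distances `‖P - P_E(B)‖_F`, `B` in the BTL class with bound `h`. -/
def btlDistances (G : SimpleGraph (Fin n)) (P : Matrix (Fin n) (Fin n) ℝ) (h : ℝ) : Set ℝ :=
  (fun B => ‖P - proj G B‖) '' btlClass n h

end BTL

end

/-! Off by the weight `π i + π j`, the matrix `skew` is exactly the error of the BTL model whose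
scores are `π` itself. These scores satisfy the ratio bound, so that model is a competitor; the
weights lie between `2‖π‖/h` and `2‖π‖`, which gives the upper bound (`norm_sub_btlMatrix_le`).

For the lower bound, let `α` be the normalized scores of any competitor and `Δ` its error. A BTL
model is reversible with respect to its scores, so `α` solves the stationary equation of `P` up to a
residual linear in `Δ` (`sum_sq_residual_le`). Edge expansion makes that equation stable: `α - π`
has total mass zero, and a Cheeger inequality for the flow `π i * S i j`, which need not be
reversible, bounds it by the residual (`sum_sq_div_le_residual`). Finally `skew` is at most the
contribution of `Δ` plus that of `α - π` (`norm_skew_sq_le`). The squared residual carries a factor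
`1 / dMax G` and the last step costs a factor `dMax G`; these cancel, so the constant is independent
of `n` and of the graph. Compactness of the normalized scores gives attainment. -/

namespace BTL

/-! ### Cheeger inequality and stability for balanced, possibly non-reversible flows -/

section Cheeger

variable {ι : Type*} [Fintype ι]

/-- Co-area inequality: an expansion bound for all subsets of the support of `f` bounds the total
positive variation of `f` from below. -/
theorem coarea_le [DecidableEq ι] (W : ι → ι → ℝ) (p : ι → ℝ) (ξ : ℝ) (U : Finset ι)
    (hU : ∀ T ⊆ U, T.Nonempty → ξ * ∑ i ∈ T, p i ≤ ∑ i ∈ T, ∑ j ∈ Tᶜ, W i j)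
    (f : ι → ℝ) (hpos : ∀ i ∈ U, 0 < f i) (hzero : ∀ i ∉ U, f i = 0) :
    ξ * ∑ i, p i * f i ≤ ∑ i, ∑ j, W i j * max (f i - f j) 0 := by
  induction U using Finset.strongInduction generalizing f with
  | H U ih =>
    rcases U.eq_empty_or_nonempty with rfl | hne
    · have hf : ∀ i, f i = 0 := fun i => hzero i (Finset.notMem_empty i)
      simp [hf]
    obtain ⟨k, hk, hmin⟩ := Finset.exists_min_image U f hne
    -- Peel off the lowest layer: subtracting the minimum `m` on `U` shrinks the support strictly,
    -- and both sides of the claim drop by `m` times the two sides of `hU U`.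
    set m := f k with hm
    have hm0 : 0 < m := hpos k hk
    set g : ι → ℝ := fun i => if i ∈ U then f i - m else 0 with hg
    set V := U.filter fun i => m < f i with hV
    have hVU : V ⊆ U := Finset.filter_subset _ _
    have hss : V ⊂ U := by
      refine Finset.ssubset_iff_subset_ne.2 ⟨hVU, fun h => ?_⟩
      have : k ∈ V := h ▸ hk
      simp [hV] at this
      linarith
    have h1 := ih V hss (fun T hT => hU T (hT.trans hVU)) g
      (fun i hi => by
        have := Finset.mem_filter.1 hi
        simp [hg, this.1]
        linarith [this.2])
      (fun i hi => by
        by_cases hiU : i ∈ U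
        · have h2 : ¬ m < f i := fun h => hi (Finset.mem_filter.2 ⟨hiU, h⟩)
          have h3 := hmin i hiU
          simp [hg, hiU]
          linarith
        · simp [hg, hiU])
    have h2 := hU U subset_rfl hne
    have eU : ∀ q : ι → ℝ, ∑ i ∈ U, q i = ∑ i, if i ∈ U then q i else 0 := fun q => by
      simp [Finset.sum_ite_mem]
    have e1 : ∑ i, p i * f i = ∑ i, p i * g i + m * ∑ i ∈ U, p i := by
      rw [eU, Finset.mul_sum, ← Finset.sum_add_distrib]
      refine Finset.sum_congr rfl fun i _ => ?_
      by_cases hi : i ∈ U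
      · simp [hg, hi]; ring
      · simp [hg, hi, hzero i hi]
    have e2 : ∑ i, ∑ j, W i j * max (f i - f j) 0 =
        ∑ i, ∑ j, W i j * max (g i - g j) 0 + m * ∑ i ∈ U, ∑ j ∈ Uᶜ, W i j := by
      have e3 : ∑ i ∈ U, ∑ j ∈ Uᶜ, W i j =
          ∑ i, ∑ j, if i ∈ U ∧ j ∉ U then W i j else 0 := by
        rw [eU]
        refine Finset.sum_congr rfl fun i _ => ?_
        by_cases hi : i ∈ U
        · simp only [hi, if_true, true_and]
          rw [← Finset.sum_filter]
          exact Finset.sum_congr (by ext; simp) fun _ _ => rfl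
        · simp [hi]
      rw [e3, Finset.mul_sum, ← Finset.sum_add_distrib]
      refine Finset.sum_congr rfl fun i _ => ?_
      rw [Finset.mul_sum, ← Finset.sum_add_distrib]
      refine Finset.sum_congr rfl fun j _ => ?_
      by_cases hi : i ∈ U <;> by_cases hj : j ∈ U
      · simp [hg, hi, hj]
      · have := hmin i hi
        simp only [hg, hi, hj, hzero j hj, if_true, if_false, not_false_eq_true, and_self]
        rw [max_eq_left (by linarith), max_eq_left (by linarith)]
        ring
      · have := hmin j hj
        simp only [hg, hi, hj, hzero i hi, if_true, if_false, false_and]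
        rw [max_eq_right (by linarith), max_eq_right (by linarith)]
        ring
      · simp [hg, hi, hj, hzero i hi, hzero j hj]
    rw [e1, e2]
    nlinarith [mul_le_mul_of_nonneg_left h2 hm0.le]

/-- Cheeger-type inequality for a nonnegative function whose support has good expansion. -/
theorem cheeger_of_nonneg [DecidableEq ι] {W : ι → ι → ℝ} {p : ι → ℝ} {ξ : ℝ} (hξ : 0 < ξ)
    (hW : ∀ i j, 0 ≤ W i j) (hrow : ∀ i, ∑ j, W i j = p i) (hcol : ∀ j, ∑ i, W i j = p j)
    {g : ι → ℝ} (hg : ∀ i, 0 ≤ g i)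
    (hexp : ∀ T : Finset ι, (∀ i ∈ T, 0 < g i) → T.Nonempty →
      ξ * ∑ i ∈ T, p i ≤ ∑ i ∈ T, ∑ j ∈ Tᶜ, W i j) :
    ξ ^ 2 / 4 * ∑ i, p i * g i ^ 2 ≤ ∑ i, ∑ j, W i j * (g i - g j) ^ 2 := by
  have h1 := coarea_le W p ξ (Finset.univ.filter fun i => 0 < g i)
    (fun T hT hne => hexp T (fun i hi => (Finset.mem_filter.1 (hT hi)).2) hne)
    (fun i => g i ^ 2) (fun i hi => by have := (Finset.mem_filter.1 hi).2; positivity)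
    (fun i hi => by
      have h0 : ¬ 0 < g i := fun h => hi (Finset.mem_filter.2 ⟨Finset.mem_univ i, h⟩)
      have h2 : g i = 0 := le_antisymm (not_lt.1 h0) (hg i)
      simp [h2])
  -- Young's inequality for `(g i - g j) * (g i + g j)`. The weights `ξ / 4` are chosen so that, by
  -- the two marginal conditions, the square terms sum to `ξ / 2` times the mass term and are
  -- absorbed by the left side of `h1`.
  have h2 : ∑ i, ∑ j, W i j * max (g i ^ 2 - g j ^ 2) 0 ≤
      ∑ i, ∑ j, (2 / ξ * (W i j * (g i - g j) ^ 2) +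
        (ξ / 4 * (W i j * g i ^ 2) + ξ / 4 * (W i j * g j ^ 2))) := by
    refine Finset.sum_le_sum fun i _ => Finset.sum_le_sum fun j _ => ?_
    have h3 : max (g i ^ 2 - g j ^ 2) 0 ≤
        2 / ξ * (g i - g j) ^ 2 + (ξ / 4 * g i ^ 2 + ξ / 4 * g j ^ 2) := by
      refine max_le ?_ (by positivity)
      have h4 : 2 / ξ * (g i - g j) ^ 2 + (ξ / 4 * g i ^ 2 + ξ / 4 * g j ^ 2)
          - (g i ^ 2 - g j ^ 2) =
          2 / ξ * ((g i - g j) - ξ / 4 * (g i + g j)) ^ 2 + ξ / 8 * (g i - g j) ^ 2 := by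
        field_simp
        ring
      have h5 : 0 ≤ 2 / ξ * ((g i - g j) - ξ / 4 * (g i + g j)) ^ 2 +
          ξ / 8 * (g i - g j) ^ 2 := by positivity
      linarith
    nlinarith [mul_le_mul_of_nonneg_left h3 (hW i j)]
  have h3 : ∑ i, ∑ j, W i j * g i ^ 2 = ∑ i, p i * g i ^ 2 :=
    Finset.sum_congr rfl fun i _ => by rw [← Finset.sum_mul, hrow]
  have h4 : ∑ i, ∑ j, W i j * g j ^ 2 = ∑ i, p i * g i ^ 2 := by
    rw [Finset.sum_comm]
    exact Finset.sum_congr rfl fun i _ => by rw [← Finset.sum_mul, hcol]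
  simp only [Finset.sum_add_distrib, ← Finset.mul_sum] at h2
  rw [h3, h4] at h2
  have h5 := h1.trans h2
  set X := ∑ i, p i * g i ^ 2
  set Y := ∑ i, ∑ j, W i j * (g i - g j) ^ 2
  have h6 : ξ / 2 * X ≤ 2 / ξ * Y := by linarith
  calc ξ ^ 2 / 4 * X = ξ / 2 * (ξ / 2 * X) := by ring
    _ ≤ ξ / 2 * (2 / ξ * Y) := by gcongr
    _ = Y := by field_simp

/-- A weighted median of a real function on a finite type. -/
theorem exists_median [Nonempty ι] (p x : ι → ℝ) (hp : ∀ i, 0 ≤ p i) :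
    ∃ m, (∑ i with m < x i, p i ≤ ∑ i with ¬ m < x i, p i) ∧
      ∑ i with x i < m, p i ≤ ∑ i with ¬ x i < m, p i := by
  obtain ⟨k₀, -, hk₀⟩ := Finset.exists_max_image Finset.univ x Finset.univ_nonempty
  -- The median is the least value in `A`. The largest value below it is not in `A`, and that
  -- failure is the second inequality.
  set A : Finset ι := Finset.univ.filter fun k =>
    ∑ i with x k < x i, p i ≤ ∑ i with ¬ x k < x i, p i with hA
  have hne : A.Nonempty := by
    refine ⟨k₀, Finset.mem_filter.2 ⟨Finset.mem_univ _, ?_⟩⟩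
    rw [Finset.filter_false_of_mem fun i hi => not_lt.2 (hk₀ i hi), Finset.sum_empty]
    exact Finset.sum_nonneg fun i _ => hp i
  obtain ⟨k, hk, hmin⟩ := Finset.exists_min_image A x hne
  refine ⟨x k, (Finset.mem_filter.1 hk).2, ?_⟩
  rcases (Finset.univ.filter fun i => x i < x k).eq_empty_or_nonempty with he | hB
  · rw [he, Finset.sum_empty]
    exact Finset.sum_nonneg fun i _ => hp i
  obtain ⟨l, hl, hmax⟩ := Finset.exists_max_image _ x hB
  have hlk : x l < x k := (Finset.mem_filter.1 hl).2
  have hlA : l ∉ A := fun h => (hmin l h).not_gt hlk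
  have h1 : ¬ (∑ i with x l < x i, p i ≤ ∑ i with ¬ x l < x i, p i) :=
    fun h => hlA (Finset.mem_filter.2 ⟨Finset.mem_univ _, h⟩)
  have h2 : ∀ i, x i < x k ↔ ¬ x l < x i := fun i =>
    ⟨fun h => not_lt.2 (hmax i (Finset.mem_filter.2 ⟨Finset.mem_univ _, h⟩)),
      fun h => (not_lt.1 h).trans_lt hlk⟩
  simp only [h2, not_not]
  exact (not_le.1 h1).le

/-- Cheeger-type inequality for a balanced nonnegative flow. -/
theorem cheeger [DecidableEq ι] [Nonempty ι] {W : ι → ι → ℝ} {p : ι → ℝ} {ξ : ℝ} (hξ : 0 < ξ)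
    (hW : ∀ i j, 0 ≤ W i j) (hrow : ∀ i, ∑ j, W i j = p i) (hcol : ∀ j, ∑ i, W i j = p j)
    (hexp : ∀ T : Finset ι, T.Nonempty → ∑ i ∈ T, p i ≤ ∑ i ∈ Tᶜ, p i →
      ξ * ∑ i ∈ T, p i ≤ ∑ i ∈ T, ∑ j ∈ Tᶜ, W i j)
    {x : ι → ℝ} (hx : ∑ i, p i * x i = 0) :
    ξ ^ 2 / 4 * ∑ i, p i * x i ^ 2 ≤ ∑ i, ∑ j, W i j * (x i - x j) ^ 2 := by
  have hp : ∀ i, 0 ≤ p i := fun i => hrow i ▸ Finset.sum_nonneg fun j _ => hW i j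
  obtain ⟨m, hm1, hm2⟩ := exists_median p x hp
  -- A set on one side of the median carries at most half of the mass, so the expansion hypothesis
  -- applies to it.
  have key : ∀ (q : ι → Prop) [DecidablePred q], ∑ i with q i, p i ≤ ∑ i with ¬ q i, p i →
      ∀ T : Finset ι, (∀ i ∈ T, q i) → T.Nonempty →
      ξ * ∑ i ∈ T, p i ≤ ∑ i ∈ T, ∑ j ∈ Tᶜ, W i j := by
    intro q _ hq T hT hne
    refine hexp T hne ?_
    calc ∑ i ∈ T, p i ≤ ∑ i with q i, p i :=
          Finset.sum_le_sum_of_subset_of_nonneg (fun i hi => by simp [hT i hi])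
            fun i _ _ => hp i
      _ ≤ ∑ i with ¬ q i, p i := hq
      _ ≤ ∑ i ∈ Tᶜ, p i :=
          Finset.sum_le_sum_of_subset_of_nonneg
            (fun i hi => Finset.mem_compl.2 fun h => (Finset.mem_filter.1 hi).2 (hT i h))
            fun i _ _ => hp i
  have h1 := cheeger_of_nonneg hξ hW hrow hcol (g := fun i => max (x i - m) 0)
    (fun i => le_max_right _ _) (fun T hT => key (fun i => m < x i) hm1 T fun i hi => by
      have := hT i hi
      simpa using this)
  have h2 := cheeger_of_nonneg hξ hW hrow hcol (g := fun i => max (m - x i) 0)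
    (fun i => le_max_right _ _) (fun T hT => key (fun i => x i < m) hm2 T fun i hi => by
      have := hT i hi
      simpa using this)
  have h3 : ∑ i, ∑ j, W i j * (max (x i - m) 0 - max (x j - m) 0) ^ 2 +
      ∑ i, ∑ j, W i j * (max (m - x i) 0 - max (m - x j) 0) ^ 2 ≤
      ∑ i, ∑ j, W i j * (x i - x j) ^ 2 := by
    simp only [← Finset.sum_add_distrib]
    refine Finset.sum_le_sum fun i _ => Finset.sum_le_sum fun j _ => ?_
    rw [← mul_add]
    refine mul_le_mul_of_nonneg_left ?_ (hW i j)
    rcases le_total (x i) m with hi | hi <;> rcases le_total (x j) m with hj | hj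
    · rw [max_eq_right (by linarith), max_eq_right (by linarith), max_eq_left (by linarith),
        max_eq_left (by linarith)]
      nlinarith
    · rw [max_eq_right (by linarith), max_eq_left (by linarith), max_eq_left (by linarith),
        max_eq_right (by linarith)]
      nlinarith [mul_nonneg (sub_nonneg.2 hi) (sub_nonneg.2 hj)]
    · rw [max_eq_left (by linarith), max_eq_right (by linarith), max_eq_right (by linarith),
        max_eq_left (by linarith)]
      nlinarith [mul_nonneg (sub_nonneg.2 hi) (sub_nonneg.2 hj)]
    · rw [max_eq_left (by linarith), max_eq_left (by linarith), max_eq_right (by linarith),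
        max_eq_right (by linarith)]
      nlinarith
  -- The second moment is smallest about the mean, here zero, so recentring at the median can only
  -- increase it.
  have h4 : ∑ i, p i * x i ^ 2 ≤
      ∑ i, p i * (max (x i - m) 0) ^ 2 + ∑ i, p i * (max (m - x i) 0) ^ 2 := by
    have h5 : ∑ i, p i * (max (x i - m) 0) ^ 2 + ∑ i, p i * (max (m - x i) 0) ^ 2 =
        ∑ i, p i * x i ^ 2 - 2 * m * ∑ i, p i * x i + m ^ 2 * ∑ i, p i := by
      rw [Finset.mul_sum, Finset.mul_sum, ← Finset.sum_add_distrib, ← Finset.sum_sub_distrib,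
        ← Finset.sum_add_distrib]
      refine Finset.sum_congr rfl fun i _ => ?_
      rcases le_total (x i) m with hi | hi
      · rw [max_eq_right (by linarith), max_eq_left (by linarith)]
        ring
      · rw [max_eq_left (by linarith), max_eq_right (by linarith)]
        ring
    rw [h5, hx]
    have : 0 ≤ m ^ 2 * ∑ i, p i := mul_nonneg (sq_nonneg m) (Finset.sum_nonneg fun i _ => hp i)
    linarith
  have h5 := mul_le_mul_of_nonneg_left h4 (by positivity : 0 ≤ ξ ^ 2 / 4)
  rw [mul_add] at h5
  exact h5.trans ((add_le_add h1 h2).trans h3)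

/-- Stability of the stationary equation of a (non-reversible) stochastic matrix under edge
expansion: a mass-zero vector is controlled by its residual. -/
theorem sum_sq_div_le_residual [DecidableEq ι] [Nonempty ι] {S : Matrix ι ι ℝ} {p : ι → ℝ} {ξ : ℝ}
    (hξ : 0 < ξ) (hp : ∀ i, 0 < p i) (hS : ∀ i j, 0 ≤ S i j) (hrow : S *ᵥ 1 = 1) (hst : p ᵥ* S = p)
    (hexp : ∀ T : Finset ι, T.Nonempty → ∑ i ∈ T, p i ≤ ∑ i ∈ Tᶜ, p i →
      ξ * ∑ i ∈ T, p i ≤ ∑ i ∈ T, ∑ j ∈ Tᶜ, p i * S i j)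
    {e : ι → ℝ} (he : ∑ i, e i = 0) :
    ∑ i, e i ^ 2 / p i ≤ 64 / ξ ^ 4 * ∑ i, (e - e ᵥ* S) i ^ 2 / p i := by
  have hr : ∀ i, ∑ j, S i j = 1 := fun i => by
    have := congrFun hrow i
    simpa [Matrix.mulVec, dotProduct] using this
  have hc : ∀ j, ∑ i, p i * S i j = p j := fun j => congrFun hst j
  have hr' : ∀ i, ∑ j, p i * S i j = p i := fun i => by rw [← Finset.mul_sum, hr, mul_one]
  set x : ι → ℝ := fun i => e i / p i with hxdef
  have hpx : ∀ i, p i * x i = e i := fun i => mul_div_cancel₀ _ (hp i).ne'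
  have h1 := cheeger hξ (W := fun i j => p i * S i j)
    (fun i j => mul_nonneg (hp i).le (hS i j)) hr' hc hexp (x := x) (by simpa only [hpx] using he)
  -- Both marginals of the flow equal `p`, so expanding the square yields the Dirichlet form without
  -- any reversibility.
  have h2 : ∑ i, ∑ j, p i * S i j * (x i - x j) ^ 2 = 2 * ∑ j, (e - e ᵥ* S) j * x j := by
    have a1 : ∑ i, ∑ j, p i * S i j * x i ^ 2 = ∑ i, e i * x i :=
      Finset.sum_congr rfl fun i _ => by rw [← Finset.sum_mul, hr', sq, ← mul_assoc, hpx]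
    have a2 : ∑ i, ∑ j, p i * S i j * x j ^ 2 = ∑ i, e i * x i := by
      rw [Finset.sum_comm]
      exact Finset.sum_congr rfl fun i _ => by rw [← Finset.sum_mul, hc, sq, ← mul_assoc, hpx]
    have a3 : ∑ i, ∑ j, p i * S i j * (x i * x j) = ∑ j, (e ᵥ* S) j * x j := by
      rw [Finset.sum_comm]
      refine Finset.sum_congr rfl fun j _ => ?_
      rw [Matrix.vecMul, dotProduct, Finset.sum_mul]
      refine Finset.sum_congr rfl fun i _ => ?_
      rw [← hpx i]
      ring
    have a4 : ∑ i, ∑ j, p i * S i j * (x i - x j) ^ 2 = ∑ i, ∑ j, p i * S i j * x i ^ 2 +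
        ∑ i, ∑ j, p i * S i j * x j ^ 2 - 2 * ∑ i, ∑ j, p i * S i j * (x i * x j) := by
      simp only [Finset.mul_sum, ← Finset.sum_add_distrib, ← Finset.sum_sub_distrib]
      exact Finset.sum_congr rfl fun i _ => Finset.sum_congr rfl fun j _ => by ring
    rw [a4, a1, a2, a3]
    simp only [Pi.sub_apply, sub_mul, Finset.sum_sub_distrib]
    ring
  have h3 : ∑ i, p i * x i ^ 2 = ∑ i, e i ^ 2 / p i :=
    Finset.sum_congr rfl fun i _ => by
      have := (hp i).ne'
      simp only [hxdef]
      field_simp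
  -- Young's inequality again: after doubling, `ξ ^ 2 / 16` is half of the Cheeger constant `ξ ^ 2 /
  -- 4`, so this term can be absorbed.
  have h4 : ∑ j, (e - e ᵥ* S) j * x j ≤
      ξ ^ 2 / 16 * ∑ j, e j ^ 2 / p j + 4 / ξ ^ 2 * ∑ j, (e - e ᵥ* S) j ^ 2 / p j := by
    rw [Finset.mul_sum, Finset.mul_sum, ← Finset.sum_add_distrib]
    refine Finset.sum_le_sum fun j _ => ?_
    set r := (e - e ᵥ* S) j
    have hpj := hp j
    have : ξ ^ 2 / 16 * (e j ^ 2 / p j) + 4 / ξ ^ 2 * (r ^ 2 / p j) - r * x j =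
        (ξ / 4 * e j - 2 / ξ * r) ^ 2 / p j := by
      simp only [hxdef]
      field_simp
      ring
    have h5 : 0 ≤ (ξ / 4 * e j - 2 / ξ * r) ^ 2 / p j := by positivity
    linarith
  rw [h2, h3] at h1
  set X := ∑ i, e i ^ 2 / p i
  set Y := ∑ i, (e - e ᵥ* S) i ^ 2 / p i
  have h5 : ξ ^ 2 / 8 * X ≤ 8 / ξ ^ 2 * Y := by
    have : 8 / ξ ^ 2 * Y = 2 * (4 / ξ ^ 2 * Y) := by ring
    linarith
  calc X = 8 / ξ ^ 2 * (ξ ^ 2 / 8 * X) := by field_simp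
    _ ≤ 8 / ξ ^ 2 * (8 / ξ ^ 2 * Y) := by gcongr
    _ = 64 / ξ ^ 4 * Y := by field_simp; ring

end Cheeger

variable {n : ℕ}

/-! ### Frobenius norm, degrees and ratios -/

theorem frobenius_sq (A : Matrix (Fin n) (Fin n) ℝ) : ‖A‖ ^ 2 = ∑ i, ∑ j, A i j ^ 2 := by
  rw [Matrix.frobenius_norm_def, ← Real.sqrt_eq_rpow, Real.sq_sqrt]
  · simp
  · positivity

theorem adjLoop_apply (G : SimpleGraph (Fin n)) [DecidableRel G.Adj] (i j : Fin n) :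
    adjLoop G i j = if i = j ∨ G.Adj i j then 1 else 0 := by
  simp only [adjLoop, Matrix.of_apply]
  congr

theorem adjLoop_nonneg (G : SimpleGraph (Fin n)) (i j : Fin n) : 0 ≤ adjLoop G i j := by
  classical
  rw [adjLoop_apply]
  split_ifs <;> norm_num

theorem adjLoop_comm (G : SimpleGraph (Fin n)) (i j : Fin n) :
    adjLoop G i j = adjLoop G j i := by
  classical
  simp only [adjLoop_apply, eq_comm, G.adj_comm]

theorem sum_adjLoop_le_dMax (G : SimpleGraph (Fin n)) (i : Fin n) :
    ∑ j, adjLoop G i j ≤ dMax G :=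
  le_ciSup (f := fun i => ∑ j, adjLoop G i j) (Set.finite_range _).bddAbove i

theorem dMax_pos [NeZero n] (G : SimpleGraph (Fin n)) : 0 < dMax G := by
  classical
  refine lt_of_lt_of_le ?_ (sum_adjLoop_le_dMax G 0)
  refine Finset.sum_pos' (fun j _ => adjLoop_nonneg G 0 j) ⟨0, Finset.mem_univ _, ?_⟩
  simp [adjLoop_apply]

/-- The division-free form is invariant under scaling and is a closed condition; both facts serve
the compactness argument. -/
theorem maxMinRatio_le_iff [NeZero n] {x : Fin n → ℝ} (hx : ∀ i, 0 < x i) {h : ℝ} :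
    maxMinRatio x ≤ h ↔ ∀ i j, x i ≤ h * x j := by
  obtain ⟨k, hk⟩ := exists_eq_ciInf_of_finite (f := x)
  obtain ⟨l, hl⟩ := exists_eq_ciSup_of_finite (f := x)
  rw [maxMinRatio, ← hk, ← hl, div_le_iff₀ (hx k)]
  refine ⟨fun hle i j => ?_, fun H => H l k⟩
  have hi : x i ≤ x l := hl ▸ le_ciSup (Set.finite_range x).bddAbove i
  have hj : x k ≤ x j := hk ▸ ciInf_le (Set.finite_range x).bddBelow j
  have hh : 0 ≤ h := by
    by_contra hneg
    nlinarith [hx k, hx l]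
  exact hi.trans (hle.trans (mul_le_mul_of_nonneg_left hj hh))

/-! ### The canonical Markov matrix -/

theorem canonicalMarkov_of_adj {G : SimpleGraph (Fin n)} {P : Matrix (Fin n) (Fin n) ℝ}
    {i j : Fin n} (h : G.Adj i j) : canonicalMarkov G P i j = P i j / (2 * dMax G) := by
  simp [canonicalMarkov, h.ne, h]

theorem canonicalMarkov_of_not_adj {G : SimpleGraph (Fin n)} {P : Matrix (Fin n) (Fin n) ℝ}
    {i j : Fin n} (hne : i ≠ j) (h : ¬ G.Adj i j) : canonicalMarkov G P i j = 0 := by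
  simp [canonicalMarkov, hne, h]

theorem canonicalMarkov_nonneg [NeZero n] {G : SimpleGraph (Fin n)}
    {P : Matrix (Fin n) (Fin n) ℝ} (hP : IsPairwiseComparisonMatrix G P) (i j : Fin n) :
    0 ≤ canonicalMarkov G P i j := by
  classical
  have hd := dMax_pos G
  rcases eq_or_ne i j with rfl | hne
  -- Since `d` is twice `dMax G` and the entries are below one, the holding probability is at least
  -- one half.
  · have h1 : ∑ k with G.Adj i k, P i k ≤ dMax G := by
      refine le_trans ?_ (sum_adjLoop_le_dMax G i)
      rw [Finset.sum_filter]
      refine Finset.sum_le_sum fun k _ => ?_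
      split_ifs with h
      · simpa [adjLoop_apply, h] using (hP.mem_Ioo i k h).2.le
      · exact adjLoop_nonneg G i k
    have h2 : canonicalMarkov G P i i = 1 - (1 / (2 * dMax G)) * ∑ k with G.Adj i k, P i k := by
      simp [canonicalMarkov]
    have h3 : (1 / (2 * dMax G)) * ∑ k with G.Adj i k, P i k ≤ (1 / (2 * dMax G)) * dMax G := by
      gcongr
    have h4 : (1 / (2 * dMax G)) * dMax G = 1 / 2 := by field_simp
    rw [h2]
    linarith
  · by_cases h : G.Adj i j
    · rw [canonicalMarkov_of_adj h]
      exact div_nonneg (hP.mem_Ioo i j h).1.le (by positivity)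
    · rw [canonicalMarkov_of_not_adj hne h]

/-- A stationary distribution on a connected graph has full support. -/
theorem IsStationary.pos [NeZero n] {G : SimpleGraph (Fin n)} {P : Matrix (Fin n) (Fin n) ℝ}
    {π : Fin n → ℝ} (hP : IsPairwiseComparisonMatrix G P) (hG : G.Connected)
    (hπ : IsStationary (canonicalMarkov G P) π) (i : Fin n) : 0 < π i := by
  have hstep : ∀ i j, G.Adj i j → π i = 0 → π j = 0 := by
    -- If `π i = 0`, every nonnegative inflow term at `i` vanishes; the one from a neighbour `j` has
    -- a positive transition factor, which forces `π j = 0`.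
    intro i j hij hi
    have h1 : ∑ k, π k * canonicalMarkov G P k i = 0 := (congrFun hπ.2 i).trans hi
    have h2 := (Finset.sum_eq_zero_iff_of_nonneg fun k _ =>
      mul_nonneg (hπ.1.1 k) (canonicalMarkov_nonneg hP k i)).1 h1 j (Finset.mem_univ j)
    refine (mul_eq_zero.1 h2).resolve_right ?_
    rw [canonicalMarkov_of_adj hij.symm]
    exact (div_pos (hP.mem_Ioo j i hij.symm).1 (mul_pos two_pos (dMax_pos G))).ne'
  refine lt_of_le_of_ne (hπ.1.1 i) fun h0 => ?_
  have hall : ∀ j, π j = 0 := fun j => by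
    obtain ⟨w⟩ := hG.preconnected i j
    have : π i = 0 → π j = 0 := by
      clear h0
      induction w with
      | nil => exact id
      | cons hadj _ ih => exact fun h => ih (hstep _ _ hadj h)
    exact this h0.symm
  have := hπ.1.2
  simp [hall] at this

/-- The edge expansion bound, stated for the flow `π i * S i j`. -/
theorem expansion_flow [NeZero n] {S : Matrix (Fin n) (Fin n) ℝ} {π : Fin n → ℝ} {ξ : ℝ}
    (hpos : ∀ i, 0 < π i)
    (h : ξ ≤ edgeExpansion (dtm S π) (fun i => √(π i)) (fun i => √(π i)))
    (T : Finset (Fin n)) (hT : T.Nonempty) (hle : ∑ i ∈ T, π i ≤ ∑ i ∈ Tᶜ, π i) :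
    ξ * ∑ i ∈ T, π i ≤ ∑ i ∈ T, ∑ j ∈ Tᶜ, π i * S i j := by
  have hTpos : 0 < ∑ i ∈ T, π i := Finset.sum_pos (fun i _ => hpos i) hT
  have hTc : Tᶜ.Nonempty := by
    by_contra he
    rw [Finset.not_nonempty_iff_eq_empty.1 he, Finset.sum_empty] at hle
    linarith
  have h1 := h.trans (ciInf_le (Set.finite_range _).bddBelow
    (⟨T, hT, hTc⟩ : {T : Finset (Fin n) // T.Nonempty ∧ (T : Finset (Fin n))ᶜ.Nonempty}))
  simp only [Real.mul_self_sqrt (hpos _).le, min_eq_left hle] at h1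
  rw [le_div_iff₀ hTpos] at h1
  refine h1.trans_eq (Finset.sum_congr rfl fun i _ => Finset.sum_congr rfl fun j _ => ?_)
  have hj := (Real.sqrt_pos.2 (hpos j)).ne'
  rw [dtm, Matrix.mul_diagonal, Matrix.diagonal_mul]
  calc √(π i) * S i j * (√(π j))⁻¹ * √(π i) * √(π j)
      = √(π i) * √(π i) * S i j * ((√(π j))⁻¹ * √(π j)) := by ring
    _ = π i * S i j := by rw [Real.mul_self_sqrt (hpos i).le, inv_mul_cancel₀ hj, mul_one]

/-! ### The BTL class -/

/-- The BTL matrix of a vector of skill scores. -/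
noncomputable def btlMatrix (α : Fin n → ℝ) : Matrix (Fin n) (Fin n) ℝ :=
  Matrix.of fun i j => α j / (α i + α j)

theorem btlMatrix_apply (α : Fin n → ℝ) (i j : Fin n) :
    btlMatrix α i j = α j / (α i + α j) := rfl

theorem btlMatrix_mem [NeZero n] {α : Fin n → ℝ} {h : ℝ} (hα : ∀ i, 0 < α i)
    (hr : ∀ i j, α i ≤ h * α j) : btlMatrix α ∈ btlClass n h := by
  refine ⟨⟨fun i j _ => ?_, fun i => ?_, fun i j hij hn => absurd hij (by simpa using hn)⟩,
    α, hα, (maxMinRatio_le_iff hα).2 hr, fun i j _ => rfl⟩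
  · have hi := hα i
    have hj := hα j
    rw [btlMatrix_apply]
    exact ⟨by positivity, (div_lt_one (by positivity)).2 (by linarith)⟩
  · have hi := (hα i).ne'
    rw [btlMatrix_apply]
    field_simp
    norm_num

/-- The skill scores of a BTL model may be normalized to a probability vector. -/
theorem exists_simplex_of_mem_btlClass [NeZero n] {B : Matrix (Fin n) (Fin n) ℝ} {h : ℝ}
    (hB : B ∈ btlClass n h) :
    ∃ α ∈ stdSimplex ℝ (Fin n), (∀ i, 0 < α i) ∧ (∀ i j, α i ≤ h * α j) ∧ B = btlMatrix α := by
  obtain ⟨hP, α, hα, hr, hBα⟩ := hB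
  rw [maxMinRatio_le_iff hα] at hr
  have hs : 0 < ∑ i, α i := Finset.sum_pos (fun i _ => hα i) Finset.univ_nonempty
  refine ⟨fun i => α i / ∑ k, α k, ⟨fun i => (div_pos (hα i) hs).le, ?_⟩,
    fun i => div_pos (hα i) hs, fun i j => ?_, ?_⟩
  · rw [← Finset.sum_div, div_self hs.ne']
  · rw [← mul_div_assoc]
    exact div_le_div_of_nonneg_right (hr i j) hs.le
  · ext i j
    have hi := hα i
    have hj := hα j
    rw [btlMatrix_apply, ← add_div, div_div_div_cancel_right₀ hs.ne']
    rcases eq_or_ne i j with rfl | hij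
    · rw [hP.diag]
      field_simp
      norm_num
    · exact hBα i j hij

/-- The distance to the BTL class is attained. -/
theorem exists_isLeast_btlDistances [NeZero n] (G : SimpleGraph (Fin n))
    (P : Matrix (Fin n) (Fin n) ℝ) {h : ℝ} (hne : (btlClass n h).Nonempty) :
    ∃ m, IsLeast (btlDistances G P h) m := by
  -- Normalized scores form a compact set on which no score vanishes: a zero score would force all
  -- scores to be zero through the ratio bound.
  set K : Set (Fin n → ℝ) := stdSimplex ℝ (Fin n) ∩ {α | ∀ i j, α i ≤ h * α j} with hK
  have hpos : ∀ α ∈ K, ∀ i, 0 < α i := by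
    rintro α ⟨hα, hr⟩ i
    refine lt_of_le_of_ne (hα.1 i) fun h0 => ?_
    have hz : ∀ j, α j = 0 := fun j =>
      le_antisymm (by have := hr j i; rwa [← h0, mul_zero] at this) (hα.1 j)
    have := hα.2
    simp [hz] at this
  have hcl : IsClosed {α : Fin n → ℝ | ∀ i j, α i ≤ h * α j} := by
    simp only [Set.ofPred_forall]
    exact isClosed_iInter fun i => isClosed_iInter fun j =>
      isClosed_le (by fun_prop) (by fun_prop)
  have hcomp : IsCompact K := (isCompact_stdSimplex ℝ (Fin n)).inter_right hcl
  have himg : btlDistances G P h = (fun α => ‖P - proj G (btlMatrix α)‖) '' K := by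
    ext m
    constructor
    · rintro ⟨B, hB, rfl⟩
      obtain ⟨α, h1, -, h3, rfl⟩ := exists_simplex_of_mem_btlClass hB
      exact ⟨α, ⟨h1, h3⟩, rfl⟩
    · rintro ⟨α, hα, rfl⟩
      exact ⟨btlMatrix α, btlMatrix_mem (hpos α hα) hα.2, rfl⟩
  have hcont : ContinuousOn (fun α => ‖P - proj G (btlMatrix α)‖) K := by
    refine ContinuousOn.norm (continuousOn_const.sub ?_)
    refine continuousOn_pi.2 fun i => continuousOn_pi.2 fun j => ?_
    simp only [proj, Matrix.hadamard_apply, btlMatrix_apply]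
    refine ContinuousOn.mul (ContinuousOn.div (by fun_prop) (by fun_prop) fun α hα => ?_)
      continuousOn_const
    exact (add_pos (hpos α hα i) (hpos α hα j)).ne'
  rw [himg]
  refine (hcomp.image_of_continuousOn hcont).exists_isLeast ?_
  rw [← himg]
  exact hne.image _

/-! ### Upper bound -/

/-- The matrix `Π P + P Π - P_E(1 πᵀ)`. -/
noncomputable def skew (G : SimpleGraph (Fin n)) (P : Matrix (Fin n) (Fin n) ℝ) (π : Fin n → ℝ) :
    Matrix (Fin n) (Fin n) ℝ :=
  Matrix.diagonal π * P + P * Matrix.diagonal π - proj G (Matrix.vecMulVec 1 π)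

theorem skew_apply (G : SimpleGraph (Fin n)) (P : Matrix (Fin n) (Fin n) ℝ) (π : Fin n → ℝ)
    (i j : Fin n) :
    skew G P π i j = π i * P i j + P i j * π j - π j * adjLoop G i j := by
  simp [skew, proj, Matrix.mul_diagonal, Matrix.diagonal_mul]

/-- On an edge, the BTL entry times `π i + π j` is `π j`, the entry subtracted in `skew`. This
identity is why the separation measures a distance to a BTL model. -/
theorem skew_apply_of_pos (G : SimpleGraph (Fin n)) (P : Matrix (Fin n) (Fin n) ℝ)
    {π : Fin n → ℝ} (hπ : ∀ i, 0 < π i) (i j : Fin n) :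
    skew G P π i j = (π i + π j) * (P - proj G (btlMatrix π)) i j := by
  have := (add_pos (hπ i) (hπ j)).ne'
  rw [skew_apply, Matrix.sub_apply, proj, Matrix.hadamard_apply, btlMatrix_apply]
  field_simp

theorem norm_le_of_sq_le {A B : Matrix (Fin n) (Fin n) ℝ} {c : ℝ} (hc : 0 ≤ c)
    (h : ‖A‖ ^ 2 ≤ c ^ 2 * ‖B‖ ^ 2) : ‖A‖ ≤ c * ‖B‖ := by
  rw [← mul_pow] at h
  exact le_of_sq_le_sq h (by positivity)

theorem norm_sub_btlMatrix_le [NeZero n] (G : SimpleGraph (Fin n))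
    (P : Matrix (Fin n) (Fin n) ℝ) {π : Fin n → ℝ} {h : ℝ} (hh : 0 < h) (hπ : ∀ i, 0 < π i)
    (hr : ∀ i j, π i ≤ h * π j) :
    ‖P - proj G (btlMatrix π)‖ ≤ h / 2 * separation G P π := by
  have hM : 0 < ‖π‖ := norm_pos_iff.2 fun h0 => (hπ 0).ne' (congrFun h0 0)
  have hMle : ∀ j, ‖π‖ ≤ h * π j := fun j =>
    (pi_norm_le_iff_of_nonneg (mul_pos hh (hπ j)).le).2 fun i => by
      rw [Real.norm_of_nonneg (hπ i).le]
      exact hr i j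
  have h1 : ‖P - proj G (btlMatrix π)‖ ≤ h / (2 * ‖π‖) * ‖skew G P π‖ := by
    refine norm_le_of_sq_le (by positivity) ?_
    rw [frobenius_sq, frobenius_sq, Finset.mul_sum]
    refine Finset.sum_le_sum fun i _ => ?_
    rw [Finset.mul_sum]
    refine Finset.sum_le_sum fun j _ => ?_
    -- What remains is `2‖π‖ ≤ h * (π i + π j)`, the sum of two instances of `hMle`.
    rw [skew_apply_of_pos G P hπ, ← mul_pow, ← mul_assoc, mul_pow]
    refine le_mul_of_one_le_left (sq_nonneg _) (one_le_pow₀ ?_)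
    rw [div_mul_eq_mul_div, le_div_iff₀ (by positivity)]
    nlinarith [hMle i, hMle j]
  refine h1.trans_eq ?_
  rw [separation, ← skew]
  field_simp

/-! ### Lower bound -/

/-- The residual of the scores of a BTL model in the stationary equation of `P`. -/
theorem sum_sq_residual_le [NeZero n] {G : SimpleGraph (Fin n)} {P : Matrix (Fin n) (Fin n) ℝ}
    {α : Fin n → ℝ} (hα : ∀ i, 0 < α i) {A : ℝ} (hA : ∀ i, α i ≤ A) :
    dMax G * ∑ j, (α - α ᵥ* canonicalMarkov G P) j ^ 2 ≤
      A ^ 2 * ‖P - proj G (btlMatrix α)‖ ^ 2 := by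
  classical
  have hd := dMax_pos G
  set Δ := P - proj G (btlMatrix α) with hΔ
  -- Writing `α j` as its total outflow cancels the holding terms. The BTL part then cancels too,
  -- since `α i * α j / (α i + α j)` is symmetric, and only `Δ` is left.
  have hres : ∀ j, (α - α ᵥ* canonicalMarkov G P) j =
      1 / (2 * dMax G) * ∑ i, adjLoop G j i * (α j * Δ j i - α i * Δ i j) := by
    intro j
    have h1 : (α ᵥ* canonicalMarkov G P) j = ∑ i, α i * canonicalMarkov G P i j := rfl
    have h2 : ∑ i, α j * canonicalMarkov G P j i = α j := by
      have := congrFun (canonicalMarkov_mulVec_one G P) j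
      simp only [Matrix.mulVec, dotProduct, Pi.one_apply, mul_one] at this
      rw [← Finset.mul_sum, this, mul_one]
    rw [Pi.sub_apply, h1]
    nth_rewrite 1 [← h2]
    rw [← Finset.sum_sub_distrib, Finset.mul_sum]
    refine Finset.sum_congr rfl fun i _ => ?_
    rcases eq_or_ne i j with rfl | hij
    · simp
    by_cases hadj : G.Adj i j
    · have hi := hα i
      have hj := hα j
      have e1 : adjLoop G j i = 1 := by simp [adjLoop_apply, hadj.symm]
      have e2 : adjLoop G i j = 1 := by simp [adjLoop_apply, hadj]
      rw [canonicalMarkov_of_adj hadj, canonicalMarkov_of_adj hadj.symm, hΔ]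
      simp only [Matrix.sub_apply, proj, Matrix.hadamard_apply, btlMatrix_apply, e1, e2]
      rw [add_comm (α j) (α i)]
      have := hd.ne'
      field_simp
      ring
    · have hadj' : ¬ G.Adj j i := fun h => hadj h.symm
      rw [canonicalMarkov_of_not_adj hij hadj, canonicalMarkov_of_not_adj hij.symm hadj']
      simp [adjLoop_apply, hij.symm, hadj']
  have hA0 : 0 ≤ A := (hα 0).le.trans (hA 0)
  have hsq : ∀ j, (α - α ᵥ* canonicalMarkov G P) j ^ 2 ≤
      1 / (4 * dMax G) * ∑ i, (2 * A ^ 2 * Δ j i ^ 2 + 2 * A ^ 2 * Δ i j ^ 2) := by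
    intro j
    -- Cauchy–Schwarz against the indicator of the closed neighbourhood costs one factor `dMax G`;
    -- against the prefactor `1 / (2 * dMax G)` squared, a net `1 / dMax G` survives.
    have h1 : (∑ i, adjLoop G j i * (α j * Δ j i - α i * Δ i j)) ^ 2 ≤
        dMax G * ∑ i, (2 * A ^ 2 * Δ j i ^ 2 + 2 * A ^ 2 * Δ i j ^ 2) := by
      refine (Finset.sum_mul_sq_le_sq_mul_sq _ _ _).trans ?_
      refine mul_le_mul ?_ ?_ (Finset.sum_nonneg fun _ _ => sq_nonneg _) hd.le
      · refine le_trans (Finset.sum_le_sum fun i _ => ?_) (sum_adjLoop_le_dMax G j)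
        rw [adjLoop_apply]
        split_ifs <;> norm_num
      · refine Finset.sum_le_sum fun i _ => ?_
        have b1 : (α j * Δ j i) ^ 2 ≤ A ^ 2 * Δ j i ^ 2 := by
          rw [mul_pow]
          have := hα j
          have := hA j
          gcongr
        have b2 : (α i * Δ i j) ^ 2 ≤ A ^ 2 * Δ i j ^ 2 := by
          rw [mul_pow]
          have := hα i
          have := hA i
          gcongr
        nlinarith [sq_nonneg (α j * Δ j i + α i * Δ i j)]
    rw [hres, mul_pow]
    calc (1 / (2 * dMax G)) ^ 2 * (∑ i, adjLoop G j i * (α j * Δ j i - α i * Δ i j)) ^ 2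
        ≤ (1 / (2 * dMax G)) ^ 2 *
          (dMax G * ∑ i, (2 * A ^ 2 * Δ j i ^ 2 + 2 * A ^ 2 * Δ i j ^ 2)) := by gcongr
      _ = _ := by field_simp; ring
  have h2 : ∑ j, ∑ i, (2 * A ^ 2 * Δ j i ^ 2 + 2 * A ^ 2 * Δ i j ^ 2) =
      4 * A ^ 2 * ‖Δ‖ ^ 2 := by
    simp only [Finset.sum_add_distrib, ← Finset.mul_sum]
    rw [Finset.sum_comm (f := fun j i => Δ i j ^ 2), ← frobenius_sq]
    ring
  calc dMax G * ∑ j, (α - α ᵥ* canonicalMarkov G P) j ^ 2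
      ≤ dMax G * ∑ j, (1 / (4 * dMax G) *
          ∑ i, (2 * A ^ 2 * Δ j i ^ 2 + 2 * A ^ 2 * Δ i j ^ 2)) := by
        gcongr with j
        exact hsq j
    _ = A ^ 2 * ‖Δ‖ ^ 2 := by
        rw [← Finset.mul_sum, h2]
        field_simp

/-- Comparison of `Π P + P Π - P_E(1 πᵀ)` with the distance to a BTL model with scores `α`. -/
theorem norm_skew_sq_le [NeZero n] (G : SimpleGraph (Fin n)) (P : Matrix (Fin n) (Fin n) ℝ)
    {π α : Fin n → ℝ} (hπ : ∀ i, 0 ≤ π i) (hα : ∀ i, 0 < α i) :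
    ‖skew G P π‖ ^ 2 ≤ 8 * ‖π‖ ^ 2 * ‖P - proj G (btlMatrix α)‖ ^ 2 +
      8 * dMax G * ∑ i, (α - π) i ^ 2 := by
  classical
  set Δ := P - proj G (btlMatrix α) with hΔ
  set e := α - π with he
  have hM : ∀ i, π i ≤ ‖π‖ := fun i => (le_abs_self _).trans (norm_le_pi_norm π i)
  have hij : ∀ i j, skew G P π i j ^ 2 ≤ 8 * ‖π‖ ^ 2 * Δ i j ^ 2 +
      (4 * (adjLoop G i j * e i ^ 2) + 4 * (adjLoop G i j * e j ^ 2)) := by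
    intro i j
    have hi := hα i
    have hj := hα j
    -- Substituting `π = α - e`, the term `t` is the part of the entry caused by the scores not
    -- being `π`. It is linear in `e`, with coefficients at most one in absolute value.
    set t := (e j * α i - e i * α j) / (α i + α j) with ht
    have h1 : skew G P π i j = (π i + π j) * Δ i j + adjLoop G i j * t := by
      have p1 : π i = α i - e i := by simp [he]
      have p2 : π j = α j - e j := by simp [he]
      rw [skew_apply, hΔ, Matrix.sub_apply, proj, Matrix.hadamard_apply, btlMatrix_apply, ht,
        p1, p2]
      field_simp
      ring
    have h2 : ((π i + π j) * Δ i j) ^ 2 ≤ 4 * ‖π‖ ^ 2 * Δ i j ^ 2 := by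
      rw [mul_pow]
      refine mul_le_mul_of_nonneg_right ?_ (sq_nonneg _)
      nlinarith [hM i, hM j, hπ i, hπ j]
    have h3 : t ^ 2 ≤ 2 * e i ^ 2 + 2 * e j ^ 2 := by
      rw [ht, div_pow, div_le_iff₀ (by positivity)]
      nlinarith [sq_nonneg (e j * α i + e i * α j), mul_pos hi hj,
        mul_nonneg (sq_nonneg (e i)) (mul_pos hi hj).le,
        mul_nonneg (sq_nonneg (e j)) (mul_pos hi hj).le,
        mul_nonneg (sq_nonneg (e i)) (sq_nonneg (α i)),
        mul_nonneg (sq_nonneg (e j)) (sq_nonneg (α j))]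
    have h4 : (adjLoop G i j * t) ^ 2 ≤ adjLoop G i j * (2 * e i ^ 2 + 2 * e j ^ 2) := by
      have : adjLoop G i j ^ 2 = adjLoop G i j := by
        rw [adjLoop_apply]
        split_ifs <;> norm_num
      rw [mul_pow, this]
      exact mul_le_mul_of_nonneg_left h3 (adjLoop_nonneg G i j)
    rw [h1]
    nlinarith [sq_nonneg ((π i + π j) * Δ i j - adjLoop G i j * t)]
  have hs : ∑ i, ∑ j, adjLoop G i j * e i ^ 2 ≤ dMax G * ∑ i, e i ^ 2 := by
    rw [Finset.mul_sum]
    refine Finset.sum_le_sum fun i _ => ?_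
    rw [← Finset.sum_mul]
    exact mul_le_mul_of_nonneg_right (sum_adjLoop_le_dMax G i) (sq_nonneg _)
  have hs' : ∑ i, ∑ j, adjLoop G i j * e j ^ 2 ≤ dMax G * ∑ i, e i ^ 2 := by
    rw [Finset.sum_comm]
    simpa only [adjLoop_comm G _ _] using hs
  have h5 := Finset.sum_le_sum fun i (_ : i ∈ Finset.univ) =>
    Finset.sum_le_sum fun j (_ : j ∈ Finset.univ) => hij i j
  simp only [Finset.sum_add_distrib, ← Finset.mul_sum] at h5
  rw [← frobenius_sq, ← frobenius_sq] at h5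
  linarith

/-- The separation is at most a constant times the distance to any BTL model. -/
theorem separation_sq_le [NeZero n] {G : SimpleGraph (Fin n)} {P : Matrix (Fin n) (Fin n) ℝ}
    {π α : Fin n → ℝ} {ξ h : ℝ} (hξ : 0 < ξ) (hh : 0 < h)
    (hP : IsPairwiseComparisonMatrix G P) (hst : IsStationary (canonicalMarkov G P) π)
    (hexp : LargeExpansion G P π ξ) (hπ : ∀ i, 0 < π i) (hr : ∀ i j, π i ≤ h * π j)
    (hα : α ∈ stdSimplex ℝ (Fin n)) (hα0 : ∀ i, 0 < α i) (hαr : ∀ i j, α i ≤ h * α j) :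
    separation G P π ^ 2 ≤ (8 + 512 * h ^ 3 / ξ ^ 4) * ‖P - proj G (btlMatrix α)‖ ^ 2 := by
  have hd := dMax_pos G
  have hM : 0 < ‖π‖ := norm_pos_iff.2 fun h0 => (hπ 0).ne' (congrFun h0 0)
  have hMi : ∀ i, π i ≤ ‖π‖ := fun i => (le_abs_self _).trans (norm_le_pi_norm π i)
  have hMle : ∀ j, ‖π‖ ≤ h * π j := fun j =>
    (pi_norm_le_iff_of_nonneg (mul_pos hh (hπ j)).le).2 fun i => by
      rw [Real.norm_of_nonneg (hπ i).le]
      exact hr i j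
  -- Both vectors have sum one, so `α j ≤ π j` for some `j`; the ratio bound on `α` carries this to
  -- every index.
  have hA : ∀ i, α i ≤ h * ‖π‖ := by
    intro i
    obtain ⟨j, -, hj⟩ : ∃ j ∈ Finset.univ, α j ≤ π j := by
      refine Finset.exists_le_of_sum_le Finset.univ_nonempty ?_
      rw [hα.2, hst.1.2]
    exact (hαr i j).trans (mul_le_mul_of_nonneg_left (hj.trans (hMi j)) hh.le)
  have h1 := sum_sq_residual_le (G := G) (P := P) hα0 hA
  have h2 := sum_sq_div_le_residual hξ hπ (canonicalMarkov_nonneg hP)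
    (canonicalMarkov_mulVec_one G P) hst.2 (expansion_flow hπ hexp) (e := α - π)
    (by simp [Finset.sum_sub_distrib, hα.2, hst.1.2])
  have h3 : α - π - (α - π) ᵥ* canonicalMarkov G P = α - α ᵥ* canonicalMarkov G P := by
    rw [Matrix.sub_vecMul, hst.2]
    abel
  rw [h3] at h2
  set r := α - α ᵥ* canonicalMarkov G P
  set Δ := P - proj G (btlMatrix α)
  -- The weights `1 / π i` lie between `1 / ‖π‖` and `h / ‖π‖`, so passing to unweighted sums costs
  -- only a factor `h`.
  have h4 : ∑ i, (α - π) i ^ 2 ≤ 64 * h / ξ ^ 4 * ∑ i, r i ^ 2 := by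
    have l1 : ∑ i, (α - π) i ^ 2 ≤ ‖π‖ * ∑ i, (α - π) i ^ 2 / π i := by
      rw [Finset.mul_sum]
      refine Finset.sum_le_sum fun i _ => ?_
      rw [← mul_div_assoc, le_div_iff₀ (hπ i), mul_comm]
      exact mul_le_mul_of_nonneg_right (hMi i) (sq_nonneg _)
    have l2 : ‖π‖ * ∑ i, r i ^ 2 / π i ≤ h * ∑ i, r i ^ 2 := by
      rw [Finset.mul_sum, Finset.mul_sum]
      refine Finset.sum_le_sum fun i _ => ?_
      rw [← mul_div_assoc, div_le_iff₀ (hπ i)]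
      nlinarith [mul_le_mul_of_nonneg_right (hMle i) (sq_nonneg (r i))]
    calc ∑ i, (α - π) i ^ 2 ≤ ‖π‖ * ∑ i, (α - π) i ^ 2 / π i := l1
      _ ≤ ‖π‖ * (64 / ξ ^ 4 * ∑ i, r i ^ 2 / π i) := by gcongr
      _ = 64 / ξ ^ 4 * (‖π‖ * ∑ i, r i ^ 2 / π i) := by ring
      _ ≤ 64 / ξ ^ 4 * (h * ∑ i, r i ^ 2) := by gcongr
      _ = 64 * h / ξ ^ 4 * ∑ i, r i ^ 2 := by ring
  rw [separation, ← skew, div_pow, div_le_iff₀ (by positivity)]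
  calc ‖skew G P π‖ ^ 2 ≤ 8 * ‖π‖ ^ 2 * ‖Δ‖ ^ 2 + 8 * dMax G * ∑ i, (α - π) i ^ 2 :=
        norm_skew_sq_le G P (fun i => (hπ i).le) hα0
    _ ≤ 8 * ‖π‖ ^ 2 * ‖Δ‖ ^ 2 + 8 * dMax G * (64 * h / ξ ^ 4 * ∑ i, r i ^ 2) := by gcongr
    _ = 8 * ‖π‖ ^ 2 * ‖Δ‖ ^ 2 + 512 * h / ξ ^ 4 * (dMax G * ∑ i, r i ^ 2) := by ring
    _ ≤ 8 * ‖π‖ ^ 2 * ‖Δ‖ ^ 2 + 512 * h / ξ ^ 4 * ((h * ‖π‖) ^ 2 * ‖Δ‖ ^ 2) := by gcongr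
    _ = (8 + 512 * h ^ 3 / ξ ^ 4) * ‖Δ‖ ^ 2 * ‖π‖ ^ 2 := by ring

end BTL

/-! ### Conclusion -/

theorem mainTheorem4 (δ ξ κ h : ℝ) (hδ : δ ∈ Set.Ioo (0 : ℝ) 1) (hξ : 0 < ξ) (hκ : 0 < κ)
    (hh : 0 < h) :
    ∃ c₁ c₂ : ℝ, 0 < c₁ ∧ 0 < c₂ ∧
      ∀ (n : ℕ), 2 ≤ n →
      ∀ (G : SimpleGraph (Fin n)) (P : Matrix (Fin n) (Fin n) ℝ) (π : Fin n → ℝ),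
        BTL.IsPairwiseComparisonMatrix G P →
        BTL.IsStationary (BTL.canonicalMarkov G P) π →
        BTL.DynamicRange G P δ →
        BTL.LargeExpansion G P π ξ →
        BTL.AlmostRegular G κ →
        BTL.BoundedPrincipalRatio π h →
        ∃ m : ℝ, IsLeast (BTL.btlDistances G P h) m ∧
          c₁ * BTL.separation G P π ≤ m ∧ m ≤ c₂ * BTL.separation G P π := by
  have hC : 0 < 8 + 512 * h ^ 3 / ξ ^ 4 := by positivity
  refine ⟨1 / √(8 + 512 * h ^ 3 / ξ ^ 4), h / 2, by positivity, by positivity, ?_⟩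
  intro n hn G P π hP hst _ hexp hG hbr
  have : NeZero n := ⟨by omega⟩
  have hπ := hst.pos hP hG.1
  have hr := (BTL.maxMinRatio_le_iff hπ).1 hbr
  -- The model with scores `π` shows that the class is nonempty and is also the competitor for the
  -- upper bound.
  have hmem := BTL.btlMatrix_mem hπ hr
  obtain ⟨m, hm⟩ := BTL.exists_isLeast_btlDistances G P ⟨_, hmem⟩
  refine ⟨m, hm, ?_, (hm.2 ⟨_, hmem, rfl⟩).trans (BTL.norm_sub_btlMatrix_le G P hh hπ hr)⟩
  obtain ⟨B, hB, rfl⟩ := hm.1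
  obtain ⟨α, hα, hα0, hαr, rfl⟩ := BTL.exists_simplex_of_mem_btlClass hB
  have h1 := BTL.separation_sq_le hξ hh hP hst hexp hπ hr hα hα0 hαr
  rw [one_div, inv_mul_le_iff₀ (by positivity)]
  refine le_of_sq_le_sq ?_ (by positivity)
  rwa [mul_pow, Real.sq_sqrt hC.le]
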